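/- **Proposition (Instance-Specific Private Sample Complexity Bounds).** All Hilbert spaces are finite-dimensional; a state is a positive semidefinite operator of unit trace, and a channel is a completely positive trace-preserving linear map. Let $T(\rho,\sigma)=\frac12\|\rho-\sigma\|_1$. A channel $\mathcal A$ is $\varepsilon$-QLDP if $\mathrm{Tr}[M\mathcal A(\omega)]\le e^{\varepsilon}\,\mathrm{Tr}[M\mathcal A(\omega')]$ for all input states $\omega,\omega'$ and all $0\le M\le I$. For states $\rho,\sigma$ on the same space let $\mathcal W^{\varepsilon}_{(\rho,\sigma)}$ be the set of all $\varepsilon$-QLDP channels $\mathcal A$ (with any finite-dimensional output space) such that $$\max\{\lambda_{\min}(\mathcal A(\rho)),\lambda_{\min}(\mathcal A(\sigma))\}\ \ge\ \frac{1}{e^{\varepsilon}+1},$$ where $\lambda_{\min}$ is the minimum eigenvalue. For $p\in(0,1)$ and $q=1-p$ let $$p_e(\rho,\sigma,p,q)=\min\{p\,\mathrm{Tr}[M_2\rho]+q\,\mathrm{Tr}[M_1\sigma]: M_1,M_2\ge 0,\ M_1+M_2=I\},$$ $$\mathrm{SC}_{(\rho,\sigma)}(\alpha,p,q)=\min\{n\in\mathbb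 N: p_e(\rho^{\otimes n},\sigma^{\otimes n},p,q)\le\alpha\}\quad(\min\emptyset=\infty),$$ $$\widehat{\mathrm{SC}}^{\varepsilon}_{(\rho,\sigma)}=\inf_{\mathcal A\in\mathcal W^{\varepsilon}_{(\rho,\sigma)}}\mathrm{SC}_{(\mathcal A(\rho),\mathcal A(\sigma))}(\alpha,p,q).$$ Let $p\in(0,1)$, $q=1-p$ and $\alpha\in(0,pq)$. Then for every $\varepsilon>0$ and all distinct states $\rho,\sigma$, the quantity $\widehat{\mathrm{SC}}^{\varepsilon}_{(\rho,\sigma)}$ is finite and $$\ln\!\Big(\frac{pq}{\alpha}\Big)\frac{1}{e^{\varepsilon}+1}\Big(\frac{e^{\varepsilon}+1}{(e^{\varepsilon}-1)\,T(\rho,\sigma)}\Big)^{2}\ \le\ \widehat{\mathrm{SC}}^{\varepsilon}_{(\rho,\sigma)}\ \le\ \left\lceil 2\ln\!\Big(\frac{\sqrt{pq}}{\alpha}\Big)\Big(\frac{e^{\varepsilon}+1}{(e^{\varepsilon}-1)\,T(\rho,\sigma)}\Big)^{2}\right\rceil .$$ Furthermore, in the regime $0<\varepsilon<1$ with $p,q,\alpha$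 held constant, $$\widehat{\mathrm{SC}}^{\varepsilon}_{(\rho,\sigma)}=\Theta\!\left(\Big(\frac{1}{\varepsilon\,T(\rho,\sigma)}\Big)^{2}\right),$$ that is, there are constants $c,C>0$ depending only on $p$ and $\alpha$ such that $c\,(\varepsilon T(\rho,\sigma))^{-2}\le\widehat{\mathrm{SC}}^{\varepsilon}_{(\rho,\sigma)}\le C\,(\varepsilon T(\rho,\sigma))^{-2}$ for all $\varepsilon\in(0,1)$ and all distinct states $\rho,\sigma$ of any finite dimension. -/

import Mathlib

noncomputable section

namespace QuantumPrivacy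

open scoped Matrix ComplexOrder

/-- A quantum state on `ℂ^ι`: a positive semidefinite matrix of unit trace. -/
def IsState {ι : Type*} [Fintype ι] (ρ : Matrix ι ι ℂ) : Prop :=
  ρ.PosSemidef ∧ ρ.trace = 1

open scoped MatrixOrder in
/-- The trace norm `‖B‖₁ = Tr √(B† B)`. -/
def traceNorm {ι : Type*} [Fintype ι] [DecidableEq ι] (B : Matrix ι ι ℂ) : ℝ :=
  (CFC.sqrt (Bᴴ * B)).trace.re

/-- The normalized trace distance `T(ρ, σ) = ½ ‖ρ - σ‖₁`. -/
def traceDist {ι : Type*} [Fintype ι] [DecidableEq ι] (ρ σ : Matrix ι ι ℂ) : ℝ :=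
  1 / 2 * traceNorm (ρ - σ)

/-- The minimum eigenvalue of a Hermitian matrix (its spectrum over `ℝ` is its finite set of
eigenvalues). -/
def minEigenvalue {ι : Type*} [Fintype ι] [DecidableEq ι] (ω : Matrix ι ι ℂ) : ℝ :=
  sInf (spectrum ℝ ω)

/-- The map `Φ ⊗ id` on operators on `ℂ^ι ⊗ ℂ^k`: `Φ` is applied to each block
`(X (·, a) (·, b))`. -/
def ampliation {ι κ : Type*} (Φ : Matrix ι ι ℂ →ₗ[ℂ] Matrix κ κ ℂ) (k : ℕ)
    (X : Matrix (ι × Fin k) (ι × Fin k) ℂ) : Matrix (κ × Fin k) (κ × Fin k) ℂ :=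
  Matrix.of fun x y => Φ (Matrix.of fun i j => X (i, x.2) (j, y.2)) x.1 y.1

/-- A quantum channel: a completely positive, trace-preserving linear map. -/
structure IsChannel {ι κ : Type*} [Fintype ι] [Fintype κ]
    (Φ : Matrix ι ι ℂ →ₗ[ℂ] Matrix κ κ ℂ) : Prop where
  completelyPositive : ∀ (k : ℕ) (X : Matrix (ι × Fin k) (ι × Fin k) ℂ),
    X.PosSemidef → (ampliation Φ k X).PosSemidef
  tracePreserving : ∀ X : Matrix ι ι ℂ, (Φ X).trace = X.trace

/-- `ε`-quantum local differential privacy of a map `Φ`: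
`Tr[M Φ(ρ)] ≤ e^ε Tr[M Φ(σ)]` for all states `ρ, σ` and all `0 ≤ M ≤ I`. -/
def IsQLDP {ι κ : Type*} [Fintype ι] [Fintype κ] [DecidableEq κ]
    (ε : ℝ) (Φ : Matrix ι ι ℂ →ₗ[ℂ] Matrix κ κ ℂ) : Prop :=
  ∀ ρ σ : Matrix ι ι ℂ, IsState ρ → IsState σ →
    ∀ M : Matrix κ κ ℂ, M.PosSemidef → (1 - M).PosSemidef →
      (M * Φ ρ).trace.re ≤ Real.exp ε * (M * Φ σ).trace.re

/-- The `n`-fold tensor power `ρ^{⊗ n}`, as a matrix on `(ℂ^ι)^{⊗ n} = ℂ^(ι^n)`. -/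
def tensorPower {ι : Type*} (ρ : Matrix ι ι ℂ) (n : ℕ) :
    Matrix (Fin n → ι) (Fin n → ι) ℂ :=
  Matrix.of fun x y => ∏ k, ρ (x k) (y k)

/-- The optimal error probability of symmetric hypothesis testing between `ρ` (prior `p`) and
`σ` (prior `q`): the minimum of `p Tr[M₂ ρ] + q Tr[M₁ σ]` over two-outcome POVMs `(M₁, M₂)`. -/
def optimalError {ι : Type*} [Fintype ι] [DecidableEq ι] (ρ σ : Matrix ι ι ℂ) (p q : ℝ) : ℝ :=
  sInf {e : ℝ | ∃ M₁ M₂ : Matrix ι ι ℂ, M₁.PosSemidef ∧ M₂.PosSemidef ∧ M₁ + M₂ = 1 ∧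
    e = p * (M₂ * ρ).trace.re + q * (M₁ * σ).trace.re}

/-- The sample complexity `SC_{(ρ,σ)}(α, p, q)`: the least `n` such that `n` copies allow for
error probability at most `α` (`⊤` if there is none). -/
def sampleComplexity {ι : Type*} [Fintype ι] [DecidableEq ι] (ρ σ : Matrix ι ι ℂ)
    (α p q : ℝ) : ℕ∞ :=
  ⨅ (n : ℕ) (_ : optimalError (tensorPower ρ n) (tensorPower σ n) p q ≤ α), (n : ℕ∞)

/-- The instance-specific class `W^ε_{(ρ,σ)}` (with output space `ℂ^κ`): the `ε`-QLDP channels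
`𝒜` with `max {λ_min(𝒜(ρ)), λ_min(𝒜(σ))} ≥ 1 / (e^ε + 1)`. -/
structure IsInstanceChannel {ι κ : Type*} [Fintype ι] [Fintype κ] [DecidableEq κ]
    (ε : ℝ) (ρ σ : Matrix ι ι ℂ) (Φ : Matrix ι ι ℂ →ₗ[ℂ] Matrix κ κ ℂ) : Prop where
  channel : IsChannel Φ
  qldp : IsQLDP ε Φ
  minEigenvalue_ge :
    1 / (Real.exp ε + 1) ≤ max (minEigenvalue (Φ ρ)) (minEigenvalue (Φ σ))

/-- The instance-specific private sample complexity: the infimum of the sample complexity for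
discriminating `𝒜(ρ)` from `𝒜(σ)`, over all channels `𝒜` in `W^ε_{(ρ,σ)}`, with output space of
arbitrary finite dimension `m` (`⊤` if no such channel achieves error `α`). -/
def instancePrivateSampleComplexity {ι : Type*} [Fintype ι]
    (ε : ℝ) (ρ σ : Matrix ι ι ℂ) (α p q : ℝ) : ℕ∞ :=
  ⨅ (m : ℕ) (Φ : Matrix ι ι ℂ →ₗ[ℂ] Matrix (Fin m) (Fin m) ℂ)
    (_ : IsInstanceChannel ε ρ σ Φ), sampleComplexity (Φ ρ) (Φ σ) α p q

end QuantumPrivacy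

end

noncomputable section

namespace QuantumPrivacy

open scoped Matrix ComplexOrder

/-! Write x = e^ε and T for the trace distance. The Jordan decomposition of the difference gives ρ -
σ = T(ω - ω') with ω, ω' states (`exists_jordan`), and both bounds reduce to classical fidelities.

Lower bound. If A Aᴴ and B Bᴴ are the two outputs, Cauchy–Schwarz shows that every test errs with
probability at least pq |Tr(Aᴴ B)|², and this overlap is multiplicative under tensor powers
(`mul_norm_trace_pow_le_optimalError`). When one output is invertible, the Fuchs–Caves basis makes
|Tr(Aᴴ B)| equal to the Bhattacharyya coefficient of two outcome distributions P, Q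
(`exists_fuchsCaves`). Privacy bounds by x the likelihood ratios of the outcomes of ω and ω' against
each other and against P and Q. Since P - Q is T times the difference of the distributions of ω and
ω', the pointwise bound |P - Q| ≤ T(x-1) min(P, Q) and the total variation bound T(x-1)/(x+1)
follow. Together they force the squared coefficient to be at least exp(-T²(x-1)²/(x+1))
(`exp_neg_le_sq_sum_sqrt_of_ratio`). Hence pq exp(-n T²(x-1)²/(x+1)) ≤ α, and taking logarithms
bounds n.

Upper bound. Measure the Helstrom projection and apply randomized response with flip probability
1/(x+1). This channel lies in the class (`randomizedResponse_isInstanceChannel`), and its outputs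
are Bernoulli with parameters a - b = T(x-1)/(x+1). The n-copy error is at most √(pq) times the n-th
power of their Bhattacharyya coefficient, which is at most exp(-(a-b)²/2). -/

/-! ### Tensor powers and the Hilbert–Schmidt inner product. -/

theorem tensorPower_mul {ι : Type*} [Fintype ι] (A B : Matrix ι ι ℂ) (n : ℕ) :
    tensorPower (A * B) n = tensorPower A n * tensorPower B n := by
  ext x y
  simp only [tensorPower, Matrix.of_apply, Matrix.mul_apply]
  rw [Finset.prod_univ_sum, Fintype.piFinset_univ]
  exact Finset.sum_congr rfl fun z _ => Finset.prod_mul_distrib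

theorem tensorPower_conjTranspose {ι : Type*} (A : Matrix ι ι ℂ) (n : ℕ) :
    tensorPower Aᴴ n = (tensorPower A n)ᴴ := by
  ext x y
  simp [tensorPower, Matrix.conjTranspose_apply]

theorem trace_tensorPower {ι : Type*} [Fintype ι] (A : Matrix ι ι ℂ) (n : ℕ) :
    (tensorPower A n).trace = A.trace ^ n := by
  simp only [tensorPower, Matrix.trace, Matrix.diag_apply, Matrix.of_apply]
  rw [← Fintype.piFinset_univ, ← Finset.prod_univ_sum (fun _ => Finset.univ) fun _ i => A i i]
  simp

/-- The Cauchy–Schwarz inequality for the Hilbert–Schmidt inner product. -/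
theorem norm_trace_conjTranspose_mul_sq_le {ι : Type*} [Fintype ι] (X Y : Matrix ι ι ℂ) :
    ‖(Xᴴ * Y).trace‖ ^ 2 ≤ (Xᴴ * X).trace.re * (Yᴴ * Y).trace.re := by
  have key : ∀ Z : Matrix ι ι ℂ, (Zᴴ * Z).trace.re = ∑ x : ι × ι, ‖Z x.2 x.1‖ ^ 2 := by
    intro Z
    rw [Fintype.sum_prod_type]
    simp only [Matrix.trace, Matrix.diag_apply, Matrix.mul_apply, Matrix.conjTranspose_apply,
      Complex.re_sum]
    refine Finset.sum_congr rfl fun i _ => Finset.sum_congr rfl fun j _ => ?_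
    rw [← Complex.normSq_eq_norm_sq, Complex.star_def, ← Complex.normSq_eq_conj_mul_self,
      Complex.ofReal_re]
  rw [key, key]
  refine le_trans ?_ (Finset.sum_mul_sq_le_sq_mul_sq _ _ _)
  gcongr
  rw [Fintype.sum_prod_type]
  simp only [Matrix.trace, Matrix.diag_apply, Matrix.mul_apply, Matrix.conjTranspose_apply]
  refine (norm_sum_le _ _).trans (Finset.sum_le_sum fun i _ => (norm_sum_le _ _).trans ?_)
  simp

/-! ### Overlap bounds on test errors, and the Fuchs–Caves measurement. -/

section Matrices

variable {ι : Type*} [Fintype ι] [DecidableEq ι]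

theorem exists_unitary_diagonal {A : Matrix ι ι ℂ} (hA : A.IsHermitian) :
    ∃ (U : Matrix ι ι ℂ) (d : ι → ℝ), Uᴴ * U = 1 ∧ U * Uᴴ = 1 ∧
      A = U * Matrix.diagonal (fun i => (d i : ℂ)) * Uᴴ := by
  refine ⟨hA.eigenvectorUnitary, hA.eigenvalues, ?_, ?_, ?_⟩
  · exact Unitary.coe_star_mul_self hA.eigenvectorUnitary
  · exact Unitary.coe_mul_star_self hA.eigenvectorUnitary
  · have h := hA.spectral_theorem
    rw [Unitary.conjStarAlgAut_apply] at h
    exact h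

open scoped MatrixOrder in
theorem exists_posSemidef_sqrt {A : Matrix ι ι ℂ} (hA : A.PosSemidef) :
    ∃ R : Matrix ι ι ℂ, R.PosSemidef ∧ R * R = A :=
  ⟨CFC.sqrt A, Matrix.nonneg_iff_posSemidef.1 (CFC.sqrt_nonneg A),
    CFC.sqrt_mul_sqrt_self A hA.nonneg⟩

theorem posSemidef_re_trace_mul_nonneg {M ρ : Matrix ι ι ℂ} (hM : M.PosSemidef)
    (hρ : ρ.PosSemidef) : 0 ≤ (M * ρ).trace.re := by
  obtain ⟨R, hR, rfl⟩ := exists_posSemidef_sqrt hρ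
  have h := (hM.conjTranspose_mul_mul_same R).trace_nonneg
  rw [hR.isHermitian.eq, Matrix.mul_assoc, Matrix.trace_mul_comm, Matrix.mul_assoc] at h
  exact (Complex.le_def.1 h).1

/-- Here a, b are the two error probabilities and u, v the overlaps seen through M₁, M₂. Expanding
(u + v)² and using AM–GM on the cross term gives pq(u + v)² ≤ (pa + qb)(p(1-a) + q(1-b)), whose
second factor is at most p + q = 1. -/
theorem mul_sq_le_of_sq_le {p q a b u v s : ℝ} (hp : 0 < p) (hq : 0 < q) (hpq : p + q = 1)
    (ha0 : 0 ≤ a) (ha1 : a ≤ 1) (hb0 : 0 ≤ b) (hb1 : b ≤ 1) (hs : 0 ≤ s) (hu : u ^ 2 ≤ (1 - a) * b) (hv : v ^ 2 ≤ a * (1 - b)) (hsu : s ≤ u + v) :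
    p * q * s ^ 2 ≤ p * a + q * b := by
  have h1 : s ^ 2 ≤ (u + v) ^ 2 := by gcongr
  have h2 : 2 * (p * q * (u * v)) ≤ p ^ 2 * (a * (1 - a)) + q ^ 2 * (b * (1 - b)) := by
    have ha : 0 ≤ a * (1 - a) := mul_nonneg ha0 (by linarith)
    have hb : 0 ≤ b * (1 - b) := mul_nonneg hb0 (by linarith)
    refine abs_le_of_sq_le_sq' ?_ (by positivity) |>.2
    have h3 : u ^ 2 * v ^ 2 ≤ ((1 - a) * b) * (a * (1 - b)) :=
      mul_le_mul hu hv (sq_nonneg _) (mul_nonneg (by linarith) hb0)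
    have h4 : (p * q) ^ 2 * (u ^ 2 * v ^ 2) ≤ (p * q) ^ 2 * (((1 - a) * b) * (a * (1 - b))) := by
      gcongr
    nlinarith [sq_nonneg (p ^ 2 * (a * (1 - a)) - q ^ 2 * (b * (1 - b)))]
  have hpq0 : 0 < p * q := mul_pos hp hq
  have h5 : p * q * u ^ 2 ≤ p * q * ((1 - a) * b) := by gcongr
  have h6 : p * q * v ^ 2 ≤ p * q * (a * (1 - b)) := by gcongr
  have h7 : p * q * s ^ 2 ≤ p * q * (u + v) ^ 2 := by gcongr
  have h8 : p * q * (u + v) ^ 2 ≤ (p * a + q * b) * (p * (1 - a) + q * (1 - b)) := by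
    nlinarith
  have h9 : p * (1 - a) + q * (1 - b) ≤ 1 := by nlinarith
  have h10 : 0 ≤ p * a + q * b := by positivity
  nlinarith

/-- Every two-outcome test between `A Aᴴ` and `B Bᴴ` has error at least `p q |Tr (Aᴴ B)|²`. -/
theorem mul_norm_trace_sq_le_error {A B M₁ M₂ : Matrix ι ι ℂ} {p q : ℝ} (hp : 0 < p) (hq : 0 < q)
    (hpq : p + q = 1) (hA : (A * Aᴴ).trace = 1) (hB : (B * Bᴴ).trace = 1)
    (h₁ : M₁.PosSemidef) (h₂ : M₂.PosSemidef) (h : M₁ + M₂ = 1) :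
    p * q * ‖(Aᴴ * B).trace‖ ^ 2
      ≤ p * (M₂ * (A * Aᴴ)).trace.re + q * (M₁ * (B * Bᴴ)).trace.re := by
  have hsplit : ∀ X : Matrix ι ι ℂ, X.trace = 1 → (M₁ * X).trace.re = 1 - (M₂ * X).trace.re := by
    intro X hX
    have : (M₁ * X).trace + (M₂ * X).trace = 1 := by
      rw [← Matrix.trace_add, ← Matrix.add_mul, h, Matrix.one_mul, hX]
    have := congrArg Complex.re this
    simp only [Complex.add_re, Complex.one_re] at this
    linarith
  have hcs : ∀ M : Matrix ι ι ℂ, M.PosSemidef →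
      ‖(Aᴴ * M * B).trace‖ ^ 2 ≤ (M * (A * Aᴴ)).trace.re * (M * (B * Bᴴ)).trace.re := by
    intro M hM
    obtain ⟨R, hR, rfl⟩ := exists_posSemidef_sqrt hM
    have := norm_trace_conjTranspose_mul_sq_le (R * A) (R * B)
    simp only [Matrix.conjTranspose_mul, hR.isHermitian.eq] at this
    have e : ∀ X : Matrix ι ι ℂ, (R * R * (X * Xᴴ)).trace = (Xᴴ * R * (R * X)).trace := by
      intro X
      rw [← Matrix.mul_assoc, Matrix.trace_mul_comm]
      simp only [Matrix.mul_assoc]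
    rw [e, e]
    simpa only [Matrix.mul_assoc] using this
  have hApos := Matrix.posSemidef_self_mul_conjTranspose A
  have hBpos := Matrix.posSemidef_self_mul_conjTranspose B
  have a0 := posSemidef_re_trace_mul_nonneg h₂ hApos
  have a1 := posSemidef_re_trace_mul_nonneg h₁ hApos
  have b0 := posSemidef_re_trace_mul_nonneg h₁ hBpos
  have b1 := posSemidef_re_trace_mul_nonneg h₂ hBpos
  have eA := hsplit _ hA
  have eB := hsplit _ hB
  have c1 := hcs M₁ h₁
  have c2 := hcs M₂ h₂
  have hb : (M₂ * (B * Bᴴ)).trace.re = 1 - (M₁ * (B * Bᴴ)).trace.re := by linarith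
  rw [eA] at c1
  rw [hb] at c2
  refine mul_sq_le_of_sq_le hp hq hpq a0 (by linarith) b0 (by linarith) (norm_nonneg _)
    c1 c2 ?_
  have : Aᴴ * B = Aᴴ * M₁ * B + Aᴴ * M₂ * B := by
    rw [← Matrix.add_mul, ← Matrix.mul_add, h, Matrix.mul_one]
  rw [this, Matrix.trace_add]
  exact norm_add_le _ _

theorem mul_norm_trace_pow_le_optimalError {A B : Matrix ι ι ℂ} {p q : ℝ} (hp : 0 < p)
    (hq : 0 < q) (hpq : p + q = 1) (hA : (A * Aᴴ).trace = 1) (hB : (B * Bᴴ).trace = 1) (n : ℕ) :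
    p * q * (‖(Aᴴ * B).trace‖ ^ 2) ^ n
      ≤ optimalError (tensorPower (A * Aᴴ) n) (tensorPower (B * Bᴴ) n) p q := by
  refine le_csInf ⟨_, 1, 0, Matrix.PosSemidef.one, Matrix.PosSemidef.zero, add_zero _, rfl⟩ ?_
  rintro e ⟨M₁, M₂, h₁, h₂, h, rfl⟩
  have key := mul_norm_trace_sq_le_error (A := tensorPower A n) (B := tensorPower B n) hp hq hpq
    (by rw [← tensorPower_conjTranspose, ← tensorPower_mul, trace_tensorPower, hA, one_pow])
    (by rw [← tensorPower_conjTranspose, ← tensorPower_mul, trace_tensorPower, hB, one_pow]) h₁ h₂ h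
  rw [← tensorPower_conjTranspose, ← tensorPower_mul, trace_tensorPower, norm_pow,
    ← tensorPower_conjTranspose, ← tensorPower_mul, ← tensorPower_mul] at key
  rwa [pow_right_comm]

/-- The Fuchs–Caves measurement: in a suitable orthonormal basis, the fidelity of two states is
that of the two distributions of outcomes. -/
theorem exists_fuchsCaves {ρ σ : Matrix ι ι ℂ} (hρ : ρ.PosSemidef) (hσ : σ.PosDef) :
    ∃ A B U : Matrix ι ι ℂ, A * Aᴴ = ρ ∧ B * Bᴴ = σ ∧ Uᴴ * U = 1 ∧ U * Uᴴ = 1 ∧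
      ‖(Aᴴ * B).trace‖ = ∑ k, √((Uᴴ * ρ * U) k k).re * √((Uᴴ * σ * U) k k).re := by
  obtain ⟨R, hR, hRR⟩ := exists_posSemidef_sqrt hσ.posSemidef
  have hRu : IsUnit R.det := by
    have h := (Matrix.isUnit_iff_isUnit_det _).1 hσ.isUnit
    rw [← hRR, Matrix.det_mul] at h
    exact isUnit_of_mul_isUnit_left h
  have hRH : Rᴴ = R := hR.isHermitian.eq
  have hRi : (R⁻¹)ᴴ = R⁻¹ := by rw [Matrix.conjTranspose_nonsing_inv, hRH]
  obtain ⟨H, hH, hHH⟩ := exists_posSemidef_sqrt (by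
    simpa only [hRH] using hρ.mul_mul_conjTranspose_same R : (R * ρ * R).PosSemidef)
  have hHH' : Hᴴ = H := hH.isHermitian.eq
  -- With R = √σ and H = √(RρR), the matrix G = R⁻¹HR⁻¹ satisfies GσG = ρ. In an eigenbasis of G the
  -- diagonal entries of ρ are therefore d² times those of σ, while Tr H = Tr(Gσ) is the overlap.
  have hG : (R⁻¹ * H * R⁻¹).PosSemidef := by
    simpa only [hRi] using hH.mul_mul_conjTranspose_same R⁻¹
  obtain ⟨U, d, hU1, hU2, hd⟩ := exists_unitary_diagonal hG.isHermitian
  have hdiag : Uᴴ * (R⁻¹ * H * R⁻¹) * U = Matrix.diagonal (fun i => (d i : ℂ)) := by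
    rw [hd]
    calc Uᴴ * (U * Matrix.diagonal (fun i => (d i : ℂ)) * Uᴴ) * U
        = (Uᴴ * U) * Matrix.diagonal (fun i => (d i : ℂ)) * (Uᴴ * U) := by
          simp only [Matrix.mul_assoc]
      _ = _ := by rw [hU1, Matrix.one_mul, Matrix.mul_one]
  have hd0 : ∀ i, 0 ≤ d i := by
    intro i
    have h := hG.conjTranspose_mul_mul_same U
    rw [hdiag, Matrix.posSemidef_diagonal_iff] at h
    exact_mod_cast h i
  have hAA : (R⁻¹ * H) * (R⁻¹ * H)ᴴ = ρ := by
    rw [Matrix.conjTranspose_mul, hRi, hHH']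
    calc R⁻¹ * H * (H * R⁻¹) = R⁻¹ * (H * H) * R⁻¹ := by simp only [Matrix.mul_assoc]
      _ = (R⁻¹ * R) * ρ * (R * R⁻¹) := by rw [hHH]; simp only [Matrix.mul_assoc]
      _ = ρ := by rw [Matrix.nonsing_inv_mul _ hRu, Matrix.mul_nonsing_inv _ hRu, Matrix.one_mul,
        Matrix.mul_one]
  have hGσG : R⁻¹ * H * R⁻¹ * σ * (R⁻¹ * H * R⁻¹) = ρ := by
    rw [← hRR]
    calc R⁻¹ * H * R⁻¹ * (R * R) * (R⁻¹ * H * R⁻¹)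
        = R⁻¹ * H * (R⁻¹ * R) * (R * R⁻¹) * (H * R⁻¹) := by simp only [Matrix.mul_assoc]
      _ = (R⁻¹ * H) * (R⁻¹ * H)ᴴ := by
        rw [Matrix.nonsing_inv_mul _ hRu, Matrix.mul_nonsing_inv _ hRu, Matrix.mul_one,
          Matrix.mul_one, Matrix.conjTranspose_mul, hRi, hHH']
      _ = ρ := hAA
  have hρU : Uᴴ * ρ * U = Matrix.diagonal (fun i => (d i : ℂ)) * (Uᴴ * σ * U) *
      Matrix.diagonal (fun i => (d i : ℂ)) := by
    rw [← hdiag]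
    -- The factors 1 are placeholders, to be replaced by U * Uᴴ.
    calc Uᴴ * ρ * U = Uᴴ * (R⁻¹ * H * R⁻¹) * 1 * σ * 1 * (R⁻¹ * H * R⁻¹) * U := by
          conv_lhs => rw [← hGσG]
          simp only [Matrix.mul_assoc, Matrix.mul_one]
      _ = _ := by
        rw [← hU2]
        simp only [Matrix.mul_assoc]
  have hσ0 : ∀ k, 0 ≤ ((Uᴴ * σ * U) k k).re := fun k =>
    (Complex.le_def.1 (hσ.posSemidef.conjTranspose_mul_mul_same U).diag_nonneg).1
  have htr : ((R⁻¹ * H)ᴴ * R).trace = (Matrix.diagonal (fun i => (d i : ℂ)) * (Uᴴ * σ * U)).trace := by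
    have e1 : (R⁻¹ * H)ᴴ * R = H := by
      rw [Matrix.conjTranspose_mul, hRi, hHH', Matrix.mul_assoc, Matrix.nonsing_inv_mul _ hRu,
        Matrix.mul_one]
    have e2 : H.trace = (R⁻¹ * H * R⁻¹ * σ).trace := by
      rw [← hRR, Matrix.mul_assoc (R⁻¹ * H), ← Matrix.mul_assoc R⁻¹, Matrix.nonsing_inv_mul _ hRu,
        Matrix.one_mul, Matrix.mul_assoc, Matrix.trace_mul_comm, Matrix.mul_assoc,
        Matrix.mul_nonsing_inv _ hRu, Matrix.mul_one]
    rw [e1, e2, ← hdiag]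
    calc (R⁻¹ * H * R⁻¹ * σ).trace = (R⁻¹ * H * R⁻¹ * 1 * σ * 1).trace := by
          rw [Matrix.mul_one, Matrix.mul_one]
      _ = ((R⁻¹ * H * R⁻¹ * U * Uᴴ * σ * U) * Uᴴ).trace := by
          rw [← hU2]
          simp only [Matrix.mul_assoc]
      _ = _ := by
          rw [Matrix.trace_mul_comm]
          simp only [Matrix.mul_assoc]
  have hreal : ∀ k, (Uᴴ * σ * U) k k = (((Uᴴ * σ * U) k k).re : ℂ) := fun k =>
    ((hσ.posSemidef.conjTranspose_mul_mul_same U).isHermitian.coe_re_apply_self k).symm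
  have hsum : (Matrix.diagonal (fun i => (d i : ℂ)) * (Uᴴ * σ * U)).trace =
      ((∑ k, d k * ((Uᴴ * σ * U) k k).re : ℝ) : ℂ) := by
    rw [Matrix.trace]
    push_cast
    refine Finset.sum_congr rfl fun k _ => ?_
    rw [Matrix.diag_apply, Matrix.diagonal_mul, ← hreal k]
  refine ⟨R⁻¹ * H, R, U, hAA, by rw [hRH, hRR], hU1, hU2, ?_⟩
  rw [htr, hsum, Complex.norm_real, Real.norm_of_nonneg
    (Finset.sum_nonneg fun k _ => mul_nonneg (hd0 k) (hσ0 k))]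
  refine Finset.sum_congr rfl fun k _ => ?_
  rw [hρU, Matrix.mul_diagonal, Matrix.diagonal_mul, hreal k]
  have : ((d k : ℂ) * (((Uᴴ * σ * U) k k).re : ℂ) * (d k : ℂ)).re =
      d k ^ 2 * ((Uᴴ * σ * U) k k).re := by
    rw [← Complex.ofReal_mul, ← Complex.ofReal_mul, Complex.ofReal_re]
    ring
  rw [this, Complex.ofReal_re, Real.sqrt_mul (sq_nonneg _), Real.sqrt_sq (hd0 k),
    mul_assoc (d k), Real.mul_self_sqrt (hσ0 k)]

end Matrices

/-! ### Classical fidelity under bounded likelihood ratios. -/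

theorem sq_sqrt_sub_sqrt_le {p q κ : ℝ} (hp : 0 ≤ p) (hq : 0 ≤ q) (hκ : 0 ≤ κ)
    (hpκ : |p - q| ≤ κ * p) (hqκ : |p - q| ≤ κ * q) :
    p + q - 2 * (√p * √q) ≤ κ * |p - q| / 4 := by
  have key : ∀ u v : ℝ, 0 ≤ u → u ≤ v → v ^ 2 - u ^ 2 ≤ κ * u ^ 2 →
      (v - u) ^ 2 ≤ κ * (v ^ 2 - u ^ 2) / 4 := by
    intro u v hu huv h
    rcases huv.eq_or_lt with rfl | hlt
    · simp
    · have hs : 0 < v + u := by linarith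
      -- The constant 4 comes from 4u² ≤ (u + v)², valid as u ≤ v.
      have h1 : 4 * ((v - u) * (v + u)) ≤ κ * (v + u) * (v + u) := by
        nlinarith [mul_nonneg hκ (sub_nonneg.2 huv), mul_nonneg hκ hu,
          mul_nonneg hκ (sq_nonneg (v - u)), mul_nonneg (mul_nonneg hκ hu) (sub_nonneg.2 huv)]
      have h2 : 4 * (v - u) ≤ κ * (v + u) := by
        refine le_of_mul_le_mul_right ?_ hs
        linarith
      nlinarith
  have hp' := Real.sq_sqrt hp
  have hq' := Real.sq_sqrt hq
  rcases le_total p q with h | h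
  · have e : |p - q| = q - p := by rw [abs_sub_comm, abs_of_nonneg (by linarith)]
    rw [e] at hpκ ⊢
    have := key (√p) (√q) (Real.sqrt_nonneg _) (Real.sqrt_le_sqrt h) (by rw [hp', hq']; exact hpκ)
    rw [hp', hq'] at this
    nlinarith
  · have e : |p - q| = p - q := abs_of_nonneg (by linarith)
    rw [e] at hqκ ⊢
    have := key (√q) (√p) (Real.sqrt_nonneg _) (Real.sqrt_le_sqrt h) (by rw [hp', hq']; exact hqκ)
    rw [hp', hq'] at this
    nlinarith

/-- For q > 0, √p√q = p·t^(-1/2) with t = p/q, and t^(-1/2) is convex: its tangent at t = r⁻² gives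
3rp/2 - r³p²/(2q). Then p²/q = 2p - q + (p-q)²/q is bounded through the likelihood ratio. Summed
over outcomes, this is a bound by the χ² divergence with r free. -/
theorem sqrt_mul_sqrt_ge_tangent {p q κ r : ℝ} (hp : 0 ≤ p) (hq : 0 ≤ q) (hr : 0 ≤ r)
    (hqκ : |p - q| ≤ κ * q) :
    3 / 2 * r * p - 1 / 2 * r ^ 3 * (2 * p - q + κ * |p - q|) ≤ √p * √q := by
  rcases hq.eq_or_lt with rfl | hq0
  · have : p = 0 := by simpa using hqκ
    simp [this]
  have hu := Real.sqrt_nonneg p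
  have hv := Real.sqrt_pos.2 hq0
  have hp' := Real.sq_sqrt hp
  have hq' := Real.sq_sqrt hq
  set u := √p
  set v := √q
  have h1 : p ^ 2 ≤ q * (2 * p - q + κ * |p - q|) := by
    have : |p - q| * |p - q| ≤ |p - q| * (κ * q) := by gcongr
    rw [abs_mul_abs_self] at this
    nlinarith
  have h2 : 0 ≤ 2 * v ^ 3 - 3 * (r * u) * v ^ 2 + (r * u) ^ 3 := by
    have : 0 ≤ (v - r * u) ^ 2 * (2 * v + r * u) := by positivity
    nlinarith
  have h3 : r ^ 3 * p ^ 2 ≤ r ^ 3 * (q * (2 * p - q + κ * |p - q|)) := by gcongr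
  have h4 : 0 ≤ u * (2 * v ^ 3 - 3 * (r * u) * v ^ 2 + (r * u) ^ 3) := mul_nonneg hu h2
  have h5 : u * (2 * v ^ 3 - 3 * (r * u) * v ^ 2 + (r * u) ^ 3)
      = 2 * (u * v) * q - 3 * r * p * q + r ^ 3 * p ^ 2 := by
    rw [← hp', ← hq']
    ring
  refine le_of_mul_le_mul_right ?_ hq0
  nlinarith

/-- Lower bound on the classical fidelity under a bounded likelihood ratio. -/
theorem exp_neg_le_sq_sum_sqrt {κ : Type*} [Fintype κ] {p q : κ → ℝ} {c y : ℝ}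
    (hp : ∀ k, 0 ≤ p k) (hq : ∀ k, 0 ≤ q k) (hp1 : ∑ k, p k = 1) (hq1 : ∑ k, q k = 1)
    (hc : 0 ≤ c) (hpc : ∀ k, |p k - q k| ≤ c * p k) (hqc : ∀ k, |p k - q k| ≤ c * q k)
    (hy : c * ∑ k, |p k - q k| ≤ 2 * y) :
    Real.exp (-y) ≤ (∑ k, √(p k) * √(q k)) ^ 2 := by
  have hS : 0 ≤ ∑ k, √(p k) * √(q k) := Finset.sum_nonneg fun k _ => by positivity
  have hy0 : 0 ≤ y := by
    have : 0 ≤ c * ∑ k, |p k - q k| := by positivity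
    linarith
  -- Neither estimate suffices for all y. The Hellinger estimate 1 - y/4 dominates exp(-y/2) for
  -- small y; for y ≥ 2 the χ² estimate works, because e^y ≥ 1 + y + y²/2 ≥ 1 + 2y.
  rcases le_total y 2 with hy2 | hy2
  · have h1 : 1 - y / 4 ≤ ∑ k, √(p k) * √(q k) := by
      have h := Finset.sum_le_sum fun k (_ : k ∈ Finset.univ) =>
        sq_sqrt_sub_sqrt_le (hp k) (hq k) hc (hpc k) (hqc k)
      rw [Finset.sum_sub_distrib, Finset.sum_add_distrib, hp1, hq1, ← Finset.mul_sum,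
        ← Finset.sum_div, ← Finset.mul_sum] at h
      linarith
    have h2 : Real.exp (-(y / 2)) ≤ 1 - y / 4 := by
      have h3 := Real.quadratic_le_exp_of_nonneg (x := y / 2) (by linarith)
      rw [Real.exp_neg, inv_le_comm₀ (Real.exp_pos _) (by linarith)]
      refine le_trans ?_ h3
      rw [inv_le_iff_one_le_mul₀ (by linarith)]
      nlinarith [mul_nonneg hy0 (sub_nonneg.2 hy2)]
    calc Real.exp (-y) = Real.exp (-(y / 2)) ^ 2 := by
          rw [← Real.exp_nat_mul]
          congr 1
          push_cast
          ring
      _ ≤ _ := by gcongr; exact h2.trans h1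
  · have hm : 0 < 1 + 2 * y := by linarith
    -- This r maximizes 3r/2 - r³(1 + 2y)/2, the summed tangent bound, and the maximum is r itself.
    set r := (√(1 + 2 * y))⁻¹ with hr
    have hr0 : 0 < r := by positivity
    have hr2 : r ^ 2 * (1 + 2 * y) = 1 := by
      rw [hr, inv_pow, Real.sq_sqrt hm.le, inv_mul_cancel₀ hm.ne']
    have h1 : r ≤ ∑ k, √(p k) * √(q k) := by
      have h := Finset.sum_le_sum fun k (_ : k ∈ Finset.univ) =>
        sqrt_mul_sqrt_ge_tangent (hp k) (hq k) hr0.le (hqc k)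
      rw [Finset.sum_sub_distrib, ← Finset.mul_sum, hp1, ← Finset.mul_sum,
        Finset.sum_add_distrib, Finset.sum_sub_distrib, ← Finset.mul_sum, hp1, hq1,
        ← Finset.mul_sum] at h
      have h3 : r ^ 3 * (c * ∑ k, |p k - q k|) ≤ r ^ 3 * (2 * y) := by gcongr
      have h4 : r ^ 3 * (1 + 2 * y) = r := by
        calc r ^ 3 * (1 + 2 * y) = r * (r ^ 2 * (1 + 2 * y)) := by ring
          _ = r := by rw [hr2, mul_one]
      nlinarith
    have h2 : Real.exp (-y) ≤ r ^ 2 := by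
      have h3 := Real.quadratic_le_exp_of_nonneg hy0
      have h4 : r ^ 2 = (1 + 2 * y)⁻¹ := eq_inv_of_mul_eq_one_left hr2
      rw [Real.exp_neg, h4]
      gcongr
      nlinarith
    exact h2.trans (by gcongr)

/-- The same for the outcome distributions of a private channel: `p - q = τ (a - b)`, and all
likelihood ratios are at most `x`. -/
theorem exp_neg_le_sq_sum_sqrt_of_ratio {κ : Type*} [Fintype κ] {p q a b : κ → ℝ} {x τ : ℝ}
    (hx : 1 < x) (hτ : 0 ≤ τ) (hp : ∀ k, 0 ≤ p k) (hq : ∀ k, 0 ≤ q k)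
    (hp1 : ∑ k, p k = 1) (hq1 : ∑ k, q k = 1) (ha1 : ∑ k, a k = 1) (hb1 : ∑ k, b k = 1)
    (h : ∀ k, p k - q k = τ * (a k - b k)) (hab : ∀ k, a k ≤ x * b k) (hba : ∀ k, b k ≤ x * a k)
    (hap : ∀ k, a k ≤ x * p k) (hbp : ∀ k, b k ≤ x * p k) (haq : ∀ k, a k ≤ x * q k)
    (hbq : ∀ k, b k ≤ x * q k) :
    Real.exp (-(τ ^ 2 * (x - 1) ^ 2 / (x + 1))) ≤ (∑ k, √(p k) * √(q k)) ^ 2 := by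
  have hD : ∀ k, |p k - q k| = τ * |a k - b k| := fun k => by
    rw [h, abs_mul, abs_of_nonneg hτ]
  -- Multiply by x: x(a - b) ≤ (x - 1)a ≤ (x - 1)xc.
  have hlin : ∀ a b c : ℝ, a ≤ x * b → a ≤ x * c → a - b ≤ (x - 1) * c := by
    intro a b c h1 h2
    refine le_of_mul_le_mul_left ?_ (show 0 < x by linarith)
    nlinarith
  have hbd : ∀ k (c : ℝ), a k ≤ x * c → b k ≤ x * c → |p k - q k| ≤ τ * (x - 1) * c := by
    intro k c h1 h2
    rw [hD, mul_assoc]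
    refine mul_le_mul_of_nonneg_left ?_ hτ
    rw [abs_le]
    exact ⟨by linarith [hlin _ _ _ (hba k) h2], hlin _ _ _ (hab k) h1⟩
  have hsum : ∑ k, |p k - q k| ≤ 2 * (τ * (x - 1) / (x + 1)) := by
    have hk : ∀ k, |p k - q k| ≤ τ * (x - 1) / (x + 1) * (a k + b k) := by
      intro k
      have : |a k - b k| ≤ (x - 1) / (x + 1) * (a k + b k) := by
        rw [div_mul_eq_mul_div, le_div_iff₀ (by linarith)]
        rcases abs_cases (a k - b k) with ⟨e, _⟩ | ⟨e, _⟩ <;> rw [e]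
        · linarith [hab k]
        · linarith [hba k]
      rw [hD, mul_div_assoc, mul_assoc]
      exact mul_le_mul_of_nonneg_left this hτ
    refine (Finset.sum_le_sum fun k _ => hk k).trans_eq ?_
    rw [← Finset.mul_sum, Finset.sum_add_distrib, ha1, hb1]
    ring
  have hc : 0 ≤ τ * (x - 1) := mul_nonneg hτ (by linarith)
  refine exp_neg_le_sq_sum_sqrt hp hq hp1 hq1 hc (fun k => hbd k _ (hap k) (hbp k))
    (fun k => hbd k _ (haq k) (hbq k)) ((mul_le_mul_of_nonneg_left hsum hc).trans_eq ?_)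
  ring

/-! ### Fidelity of the outputs of private channels, and the lower bound on n. -/

section Channels

variable {ι κ : Type*} [Fintype ι] [Fintype κ]

theorem IsChannel.isState {Φ : Matrix ι ι ℂ →ₗ[ℂ] Matrix κ κ ℂ} (hΦ : IsChannel Φ)
    {ρ : Matrix ι ι ℂ} (hρ : IsState ρ) : IsState (Φ ρ) := by
  refine ⟨?_, by rw [hΦ.tracePreserving, hρ.2]⟩
  -- Positivity is complete positivity with a one-dimensional ancilla.
  have h := hΦ.completelyPositive 1 (ρ.submatrix Prod.fst Prod.fst) (hρ.1.submatrix _)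
  exact h.submatrix (fun i : κ => (i, (0 : Fin 1)))

theorem IsState.diag_nonneg {ω : Matrix κ κ ℂ} (hω : IsState ω) (U : Matrix κ κ ℂ) (k : κ) :
    0 ≤ ((Uᴴ * ω * U) k k).re :=
  (Complex.le_def.1 (hω.1.conjTranspose_mul_mul_same U).diag_nonneg).1

variable [DecidableEq κ]

theorem re_trace_rankOne_mul (U ω : Matrix κ κ ℂ) (k : κ) :
    (U * Matrix.single k k 1 * Uᴴ * ω).trace = (Uᴴ * ω * U) k k := by
  rw [Matrix.mul_assoc, Matrix.mul_assoc, Matrix.trace_mul_comm, Matrix.mul_assoc,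
    Matrix.trace_single_mul]
  simp

/-- Privacy is applied to the projection onto the k-th column of U, so likelihood ratios are
controlled in every orthonormal basis, in particular the Fuchs–Caves one. -/
theorem IsQLDP.diag_le {ε : ℝ} {Φ : Matrix ι ι ℂ →ₗ[ℂ] Matrix κ κ ℂ} (hΦ : IsQLDP ε Φ)
    {ρ σ : Matrix ι ι ℂ} (hρ : IsState ρ) (hσ : IsState σ) {U : Matrix κ κ ℂ}
    (hU : U * Uᴴ = 1) (k : κ) :
    ((Uᴴ * Φ ρ * U) k k).re ≤ Real.exp ε * ((Uᴴ * Φ σ * U) k k).re := by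
  have e : Matrix.single k k (1 : ℂ) = Matrix.diagonal (Pi.single k 1) :=
    (Matrix.diagonal_single k 1).symm
  have h1 : (U * Matrix.single k k 1 * Uᴴ).PosSemidef := by
    refine Matrix.PosSemidef.mul_mul_conjTranspose_same ?_ U
    rw [e, Matrix.posSemidef_diagonal_iff]
    intro i
    by_cases hi : i = k
    · subst hi; simp
    · simp [hi]
  have h2 : (1 - U * Matrix.single k k 1 * Uᴴ).PosSemidef := by
    have : 1 - U * Matrix.single k k 1 * Uᴴ = U * (1 - Matrix.single k k 1) * Uᴴ := by
      rw [Matrix.mul_sub, Matrix.sub_mul, Matrix.mul_one, hU]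
    rw [this]
    refine Matrix.PosSemidef.mul_mul_conjTranspose_same ?_ U
    rw [e, ← Matrix.diagonal_one, Matrix.diagonal_sub, Matrix.posSemidef_diagonal_iff]
    intro i
    by_cases hi : i = k
    · subst hi; simp
    · simp [hi]
  have h := hΦ ρ σ hρ hσ _ h1 h2
  rwa [re_trace_rankOne_mul, re_trace_rankOne_mul] at h

/-- The eigenvalue condition of the class enters the lower bound only through this: it makes one of
the outputs invertible, as the Fuchs–Caves construction needs. -/
theorem posDef_of_minEigenvalue_pos {ω : Matrix κ κ ℂ} (hω : ω.PosSemidef)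
    (h : 0 < minEigenvalue ω) : ω.PosDef := by
  rw [hω.isHermitian.posDef_iff_eigenvalues_pos]
  intro i
  refine h.trans_le ?_
  rw [minEigenvalue, hω.isHermitian.spectrum_real_eq_range_eigenvalues]
  exact csInf_le (Set.finite_range _).bddBelow ⟨i, rfl⟩

theorem IsState.sum_diag {ω : Matrix κ κ ℂ} (hω : IsState ω) {U : Matrix κ κ ℂ}
    (hU : U * Uᴴ = 1) : ∑ k, ((Uᴴ * ω * U) k k).re = 1 := by
  have : (Uᴴ * ω * U).trace = 1 := by
    rw [Matrix.trace_mul_comm, ← Matrix.mul_assoc, hU, Matrix.one_mul, hω.2]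
  simpa [Matrix.trace] using congrArg Complex.re this

/-- The fidelity of the outputs of a private channel is bounded below. -/
theorem exists_purification_of_qldp {ε τ : ℝ} (hε : 0 < ε) (hτ : 0 ≤ τ)
    {Φ : Matrix ι ι ℂ →ₗ[ℂ] Matrix κ κ ℂ} (hΦ : IsChannel Φ) (hΦε : IsQLDP ε Φ)
    {ρ σ ω ω' : Matrix ι ι ℂ} (hρ : IsState ρ) (hσ : IsState σ) (hω : IsState ω)
    (hω' : IsState ω') (h : ρ - σ = (τ : ℂ) • (ω - ω')) (hpd : (Φ σ).PosDef) :
    ∃ A B : Matrix κ κ ℂ, A * Aᴴ = Φ ρ ∧ B * Bᴴ = Φ σ ∧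
      Real.exp (-(τ ^ 2 * (Real.exp ε - 1) ^ 2 / (Real.exp ε + 1))) ≤ ‖(Aᴴ * B).trace‖ ^ 2 := by
  obtain ⟨A, B, U, hA, hB, -, hU, htr⟩ := exists_fuchsCaves (hΦ.isState hρ).1 hpd
  refine ⟨A, B, hA, hB, ?_⟩
  rw [htr]
  refine exp_neg_le_sq_sum_sqrt_of_ratio (a := fun k => ((Uᴴ * Φ ω * U) k k).re)
    (b := fun k => ((Uᴴ * Φ ω' * U) k k).re) (Real.one_lt_exp_iff.2 hε) hτ
    ((hΦ.isState hρ).diag_nonneg U) ((hΦ.isState hσ).diag_nonneg U) ((hΦ.isState hρ).sum_diag hU)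
    ((hΦ.isState hσ).sum_diag hU) ((hΦ.isState hω).sum_diag hU) ((hΦ.isState hω').sum_diag hU)
    (fun k => ?_) (hΦε.diag_le hω hω' hU) (hΦε.diag_le hω' hω hU) (hΦε.diag_le hω hρ hU)
    (hΦε.diag_le hω' hρ hU) (hΦε.diag_le hω hσ hU) (hΦε.diag_le hω' hσ hU)
  have e : Uᴴ * Φ ρ * U - Uᴴ * Φ σ * U = (τ : ℂ) • (Uᴴ * Φ ω * U - Uᴴ * Φ ω' * U) := by
    rw [← Matrix.sub_mul, ← Matrix.mul_sub, ← map_sub, h, map_smul, map_sub, Matrix.mul_smul,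
      Matrix.smul_mul, Matrix.mul_sub, Matrix.sub_mul]
  have := congrArg (fun X : Matrix κ κ ℂ => (X k k).re) e
  simpa using this

theorem mul_exp_neg_le_optimalError {ε τ p q : ℝ} (hε : 0 < ε) (hτ : 0 ≤ τ) (hp : 0 < p)
    (hq : 0 < q) (hpq : p + q = 1)
    {Φ : Matrix ι ι ℂ →ₗ[ℂ] Matrix κ κ ℂ} {ρ σ ω ω' : Matrix ι ι ℂ} (hρ : IsState ρ)
    (hσ : IsState σ) (hω : IsState ω) (hω' : IsState ω') (h : ρ - σ = (τ : ℂ) • (ω - ω'))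
    (hΦ : IsInstanceChannel ε ρ σ Φ) (n : ℕ) :
    p * q * Real.exp (-(τ ^ 2 * (Real.exp ε - 1) ^ 2 / (Real.exp ε + 1))) ^ n
      ≤ optimalError (tensorPower (Φ ρ) n) (tensorPower (Φ σ) n) p q := by
  have hAB : ∃ A B : Matrix κ κ ℂ, A * Aᴴ = Φ ρ ∧ B * Bᴴ = Φ σ ∧
      Real.exp (-(τ ^ 2 * (Real.exp ε - 1) ^ 2 / (Real.exp ε + 1))) ≤ ‖(Aᴴ * B).trace‖ ^ 2 := by
    have hβ : 0 < 1 / (Real.exp ε + 1) := by positivity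
    rcases lt_max_iff.1 (hβ.trans_le hΦ.minEigenvalue_ge) with hl | hl
    -- Here Φ ρ is the invertible output, so the roles of ρ, σ and of ω, ω' are exchanged; the
    -- overlap only gets conjugated.
    · obtain ⟨B, A, hB, hA, hBA⟩ := exists_purification_of_qldp hε hτ hΦ.channel hΦ.qldp hσ hρ hω'
        hω (by rw [← neg_sub, h, ← smul_neg, neg_sub])
        (posDef_of_minEigenvalue_pos (hΦ.channel.isState hρ).1 hl)
      refine ⟨A, B, hA, hB, hBA.trans_eq ?_⟩
      rw [← norm_star, ← Matrix.trace_conjTranspose, Matrix.conjTranspose_mul,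
        Matrix.conjTranspose_conjTranspose]
    · exact exists_purification_of_qldp hε hτ hΦ.channel hΦ.qldp hρ hσ hω hω' h
        (posDef_of_minEigenvalue_pos (hΦ.channel.isState hσ).1 hl)
  obtain ⟨A, B, hA, hB, hle⟩ := hAB
  have := mul_norm_trace_pow_le_optimalError hp hq hpq
    (by rw [hA, (hΦ.channel.isState hρ).2]) (by rw [hB, (hΦ.channel.isState hσ).2]) n
  rw [hA, hB] at this
  refine le_trans ?_ this
  gcongr

/-- The lower bound on the number of copies. -/
theorem le_of_optimalError_le {ε τ p q α : ℝ} (hε : 0 < ε) (hτ : 0 < τ) (hp : 0 < p)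
    (hq : 0 < q) (hpq : p + q = 1) (hα : 0 < α)
    {Φ : Matrix ι ι ℂ →ₗ[ℂ] Matrix κ κ ℂ} {ρ σ ω ω' : Matrix ι ι ℂ} (hρ : IsState ρ)
    (hσ : IsState σ) (hω : IsState ω) (hω' : IsState ω') (h : ρ - σ = (τ : ℂ) • (ω - ω'))
    (hΦ : IsInstanceChannel ε ρ σ Φ) {n : ℕ}
    (hn : optimalError (tensorPower (Φ ρ) n) (tensorPower (Φ σ) n) p q ≤ α) :
    Real.log (p * q / α) * (1 / (Real.exp ε + 1)) *
      ((Real.exp ε + 1) / ((Real.exp ε - 1) * τ)) ^ 2 ≤ n := by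
  have h1 := (mul_exp_neg_le_optimalError hε hτ.le hp hq hpq hρ hσ hω hω' h hΦ n).trans hn
  have hx : 0 < Real.exp ε - 1 := sub_pos.2 (Real.one_lt_exp_iff.2 hε)
  have hx' : 0 < Real.exp ε + 1 := by positivity
  have hpq0 : 0 < p * q := mul_pos hp hq
  set y := τ ^ 2 * (Real.exp ε - 1) ^ 2 / (Real.exp ε + 1) with hy
  have hy0 : 0 < y := by positivity
  have h2 : p * q / α ≤ Real.exp (n * y) := by
    rw [← Real.exp_nat_mul, mul_neg, Real.exp_neg, ← div_eq_mul_inv,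
      div_le_iff₀ (Real.exp_pos _)] at h1
    rw [div_le_iff₀ hα]
    linarith
  have h3 : Real.log (p * q / α) ≤ n * y := (Real.log_le_iff_le_exp (by positivity)).2 h2
  have e : Real.log (p * q / α) * (1 / (Real.exp ε + 1)) *
      ((Real.exp ε + 1) / ((Real.exp ε - 1) * τ)) ^ 2 = Real.log (p * q / α) / y := by
    rw [hy]
    field_simp
  rw [e, div_le_iff₀ hy0]
  exact h3

end Channels

/-! ### Spectral calculus and the Jordan decomposition. -/

theorem trace_conj_diagonal {ι : Type*} [Fintype ι] [DecidableEq ι] {U : Matrix ι ι ℂ}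
    (hU : Uᴴ * U = 1) (f : ι → ℝ) :
    (U * Matrix.diagonal (fun i => (f i : ℂ)) * Uᴴ).trace = ((∑ i, f i : ℝ) : ℂ) := by
  rw [Matrix.trace_mul_comm, ← Matrix.mul_assoc, hU, Matrix.one_mul, Matrix.trace_diagonal]
  push_cast
  rfl

theorem conj_diagonal_mul {ι : Type*} [Fintype ι] [DecidableEq ι] {U : Matrix ι ι ℂ}
    (hU : Uᴴ * U = 1) (f g : ι → ℝ) :
    (U * Matrix.diagonal (fun i => (f i : ℂ)) * Uᴴ) * (U * Matrix.diagonal (fun i => (g i : ℂ)) * Uᴴ)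
      = U * Matrix.diagonal (fun i => ((f i * g i : ℝ) : ℂ)) * Uᴴ := by
  calc _ = U * Matrix.diagonal (fun i => (f i : ℂ)) * (Uᴴ * U) *
        Matrix.diagonal (fun i => (g i : ℂ)) * Uᴴ := by simp only [Matrix.mul_assoc]
    _ = _ := by
      rw [hU, Matrix.mul_one, Matrix.mul_assoc U, Matrix.diagonal_mul_diagonal]
      simp

theorem posSemidef_conj_diagonal {ι : Type*} [Fintype ι] [DecidableEq ι] (U : Matrix ι ι ℂ)
    {f : ι → ℝ} (hf : ∀ i, 0 ≤ f i) :
    (U * Matrix.diagonal (fun i => (f i : ℂ)) * Uᴴ).PosSemidef := by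
  refine Matrix.PosSemidef.mul_mul_conjTranspose_same ?_ U
  rw [Matrix.posSemidef_diagonal_iff]
  exact fun i => by exact_mod_cast hf i

open scoped MatrixOrder in
theorem traceNorm_conj_diagonal {ι : Type*} [Fintype ι] [DecidableEq ι] {U : Matrix ι ι ℂ}
    (hU : Uᴴ * U = 1) (d : ι → ℝ) :
    traceNorm (U * Matrix.diagonal (fun i => (d i : ℂ)) * Uᴴ) = ∑ i, |d i| := by
  have hH : (U * Matrix.diagonal (fun i => (d i : ℂ)) * Uᴴ)ᴴ =
      U * Matrix.diagonal (fun i => (d i : ℂ)) * Uᴴ := by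
    rw [Matrix.conjTranspose_mul, Matrix.conjTranspose_mul, Matrix.conjTranspose_conjTranspose,
      Matrix.diagonal_conjTranspose, Matrix.mul_assoc]
    congr 3
    ext i
    simp
  have : CFC.sqrt ((U * Matrix.diagonal (fun i => (d i : ℂ)) * Uᴴ)ᴴ *
      (U * Matrix.diagonal (fun i => (d i : ℂ)) * Uᴴ)) =
      U * Matrix.diagonal (fun i => ((|d i| : ℝ) : ℂ)) * Uᴴ := by
    refine CFC.sqrt_unique ?_ (posSemidef_conj_diagonal U fun i => abs_nonneg (d i)).nonneg
    rw [hH, conj_diagonal_mul hU, conj_diagonal_mul hU]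
    simp only [abs_mul_abs_self]
  rw [traceNorm, this, trace_conj_diagonal hU, Complex.ofReal_re]

/-- Jordan decomposition of the difference of two states, with its Helstrom projection. -/
theorem exists_jordan {ι : Type*} [Fintype ι] [DecidableEq ι] {ρ σ : Matrix ι ι ℂ}
    (hρ : IsState ρ) (hσ : IsState σ) (hne : ρ ≠ σ) :
    0 < traceDist ρ σ ∧ traceDist ρ σ ≤ 1 ∧
    (∃ ω ω' : Matrix ι ι ℂ, IsState ω ∧ IsState ω' ∧
      ρ - σ = (traceDist ρ σ : ℂ) • (ω - ω')) ∧
    ∃ E : Matrix ι ι ℂ, E.PosSemidef ∧ (1 - E).PosSemidef ∧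
      (E * ρ).trace.re - (E * σ).trace.re = traceDist ρ σ := by
  obtain ⟨U, d, hU, hU', hd⟩ := exists_unitary_diagonal (hρ.1.isHermitian.sub hσ.1.isHermitian)
  -- Zero trace makes the positive and negative parts have equal mass, which is thus half the trace
  -- norm.
  have hsum0 : ∑ i, d i = 0 := by
    have h := congrArg Matrix.trace hd
    rw [trace_conj_diagonal hU, Matrix.trace_sub, hρ.2, hσ.2, sub_self] at h
    exact_mod_cast h.symm
  have hT : traceDist ρ σ = 1 / 2 * ∑ i, |d i| := by
    rw [traceDist, hd, traceNorm_conj_diagonal hU]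
  have hmax : traceDist ρ σ = ∑ i, max (d i) 0 := by
    have : ∀ i, max (d i) 0 = 1 / 2 * |d i| + 1 / 2 * d i := fun i => by
      rcases le_total (d i) 0 with h | h
      · rw [max_eq_right h, abs_of_nonpos h]; ring
      · rw [max_eq_left h, abs_of_nonneg h]; ring
    simp only [this]
    rw [Finset.sum_add_distrib, ← Finset.mul_sum, ← Finset.mul_sum, hsum0, hT]
    ring
  have hmin : traceDist ρ σ = ∑ i, max (-d i) 0 := by
    have : ∀ i, max (-d i) 0 = max (d i) 0 - d i := fun i => by
      rcases le_total (d i) 0 with h | h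
      · rw [max_eq_right h, max_eq_left (by linarith)]; ring
      · rw [max_eq_left h, max_eq_right (by linarith)]; ring
    simp only [this]
    rw [Finset.sum_sub_distrib, hsum0, hmax, sub_zero]
  have hpos : 0 < traceDist ρ σ := by
    refine lt_of_le_of_ne (by rw [hT]; positivity) fun h0 => hne ?_
    have h1 : ∑ i, |d i| = 0 := by linarith
    rw [Finset.sum_eq_zero_iff_of_nonneg fun i _ => abs_nonneg (d i)] at h1
    have h2 : ∀ i, d i = 0 := fun i => abs_eq_zero.1 (h1 i (Finset.mem_univ i))
    rw [← sub_eq_zero, hd]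
    simp [h2]
  set τ := traceDist ρ σ
  have hE1 : (U * Matrix.diagonal (fun i => (((if 0 < d i then 1 else 0 : ℝ)) : ℂ)) *
      Uᴴ).PosSemidef := posSemidef_conj_diagonal U fun i => by split_ifs <;> norm_num
  have hE2 : (1 - U * Matrix.diagonal (fun i => (((if 0 < d i then 1 else 0 : ℝ)) : ℂ)) *
      Uᴴ).PosSemidef := by
    have e : (1 : Matrix ι ι ℂ) = U * Matrix.diagonal (fun _ => ((1 : ℝ) : ℂ)) * Uᴴ := by
      simp [hU']
    rw [e, ← Matrix.sub_mul, ← Matrix.mul_sub, Matrix.diagonal_sub]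
    simp only [← Complex.ofReal_sub]
    exact posSemidef_conj_diagonal U fun i => by split_ifs <;> norm_num
  have hE3 : ((U * Matrix.diagonal (fun i => (((if 0 < d i then 1 else 0 : ℝ)) : ℂ)) * Uᴴ) *
      ρ).trace.re - ((U * Matrix.diagonal (fun i => (((if 0 < d i then 1 else 0 : ℝ)) : ℂ)) * Uᴴ) *
      σ).trace.re = τ := by
    rw [← Complex.sub_re, ← Matrix.trace_sub, ← Matrix.mul_sub, hd, conj_diagonal_mul hU,
      trace_conj_diagonal hU, Complex.ofReal_re, hmax]
    refine Finset.sum_congr rfl fun i _ => ?_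
    split_ifs with h
    · rw [one_mul, max_eq_left h.le]
    · rw [zero_mul, max_eq_right (not_lt.1 h)]
  have hstate : ∀ f : ι → ℝ, (∀ i, 0 ≤ f i) → τ = ∑ i, f i →
      IsState (U * Matrix.diagonal (fun i => ((τ⁻¹ * f i : ℝ) : ℂ)) * Uᴴ) := by
    intro f hf hs
    refine ⟨posSemidef_conj_diagonal U fun i => mul_nonneg (inv_nonneg.2 hpos.le) (hf i), ?_⟩
    rw [trace_conj_diagonal hU, ← Finset.mul_sum, ← hs, inv_mul_cancel₀ hpos.ne',
      Complex.ofReal_one]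
  refine ⟨hpos, ?_, ⟨_, _, hstate (fun i => max (d i) 0) (fun i => le_max_right _ _) hmax,
    hstate (fun i => max (-d i) 0) (fun i => le_max_right _ _) hmin, ?_⟩, _, hE1, hE2, hE3⟩
  · have h1 := posSemidef_re_trace_mul_nonneg hE2 hρ.1
    have h2 := posSemidef_re_trace_mul_nonneg hE1 hσ.1
    rw [Matrix.sub_mul, Matrix.one_mul, Matrix.trace_sub, hρ.2, Complex.sub_re,
      Complex.one_re] at h1
    linarith
  · rw [hd, ← Matrix.sub_mul, ← Matrix.mul_sub, Matrix.diagonal_sub, ← Matrix.smul_mul,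
      ← Matrix.mul_smul, ← Matrix.diagonal_smul]
    congr 3
    ext i
    simp only [Pi.smul_apply, smul_eq_mul]
    rw [← Complex.ofReal_sub, ← Complex.ofReal_mul, ← mul_sub, ← mul_assoc,
      mul_inv_cancel₀ hpos.ne', one_mul]
    congr 1
    rcases le_total (d i) 0 with h | h
    · rw [max_eq_right h, max_eq_left (by linarith)]; ring
    · rw [max_eq_left h, max_eq_right (by linarith)]; ring

/-! ### Measurement channels. -/

/-- The measurement channel of a POVM `E`, with a classical (diagonal) output. -/
def measurementChannel {ι κ : Type*} [Fintype ι] [DecidableEq κ] (E : κ → Matrix ι ι ℂ) :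
    Matrix ι ι ℂ →ₗ[ℂ] Matrix κ κ ℂ where
  toFun X := Matrix.diagonal fun k => (E k * X).trace
  map_add' X Y := by
    rw [Matrix.diagonal_add]
    simp only [Matrix.mul_add, Matrix.trace_add]
  map_smul' c X := by
    rw [RingHom.id_apply, ← Matrix.diagonal_smul]
    congr 1
    ext k
    simp [Matrix.trace_smul]

theorem measurementChannel_isChannel {ι κ : Type*} [Fintype ι] [DecidableEq ι] [Fintype κ]
    [DecidableEq κ] {E : κ → Matrix ι ι ℂ} (hE : ∀ k, (E k).PosSemidef) (h1 : ∑ k, E k = 1) :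
    IsChannel (measurementChannel E) where
  completelyPositive n X hX := by
    choose R hR hRR using fun k => exists_posSemidef_sqrt (hE k)
    -- Kraus operators |k⟩⟨l|√(E k) ⊗ 1 of the ampliated channel.
    let K : κ → ι → Matrix (κ × Fin n) (ι × Fin n) ℂ := fun k l =>
      Matrix.of fun y x => if y.1 = k then (if y.2 = x.2 then R k l x.1 else 0) else 0
    have key : ampliation (measurementChannel E) n X = ∑ k, ∑ l, K k l * X * (K k l)ᴴ := by
      ext ⟨y, a⟩ ⟨y', b⟩
      have hK : ∀ k l, (K k l * X * (K k l)ᴴ) (y, a) (y', b) =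
          if y = k then (if y' = k then ∑ j, ∑ i, R k l i * X (i, a) (j, b) * R k j l else 0)
          else 0 := by
        intro k l
        simp only [Matrix.mul_apply, Matrix.conjTranspose_apply, K, Matrix.of_apply,
          Fintype.sum_prod_type]
        by_cases h : y = k
        · by_cases h' : y' = k
          · simp only [h, h', if_true, ite_mul, zero_mul, Finset.sum_ite_eq, Finset.mem_univ,
              apply_ite star, star_zero, mul_ite, mul_zero, Finset.sum_mul]
            refine Finset.sum_congr rfl fun j _ => Finset.sum_congr rfl fun i _ => ?_
            rw [← Matrix.conjTranspose_apply (R k), (hR k).isHermitian.eq]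
          · simp [h, h']
        · simp [h]
      simp only [Matrix.sum_apply, hK]
      rw [Finset.sum_eq_single y (fun k _ hk => by simp [hk.symm]) (by simp)]
      simp only [if_true, ampliation, Matrix.of_apply, measurementChannel, LinearMap.coe_mk,
        AddHom.coe_mk, Matrix.diagonal_apply]
      by_cases h : y = y'
      · subst h
        simp only [if_true]
        rw [← hRR y, Matrix.mul_assoc, Matrix.trace_mul_comm]
        simp only [Matrix.trace, Matrix.diag_apply, Matrix.mul_apply, Matrix.of_apply,
          Finset.sum_mul]
      · simp [h, Ne.symm h]
    rw [key]
    exact Matrix.posSemidef_sum _ fun k _ => Matrix.posSemidef_sum _ fun l _ =>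
      hX.mul_mul_conjTranspose_same _
  tracePreserving X := by
    simp only [measurementChannel, LinearMap.coe_mk, AddHom.coe_mk]
    rw [Matrix.trace_diagonal, ← Matrix.trace_sum, ← Finset.sum_mul, h1, Matrix.one_mul]

/-! ### Bhattacharyya upper bounds for classical tests. -/

/-- The likelihood-ratio test has error ∑ min(pP, qQ), and the minimum is at most the geometric
mean. -/
theorem optimalError_diagonal_le {κ : Type*} [Fintype κ] [DecidableEq κ] {P Q : κ → ℝ}
    (hP : ∀ k, 0 ≤ P k) (hQ : ∀ k, 0 ≤ Q k) {p q : ℝ} (hp : 0 ≤ p) (hq : 0 ≤ q) :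
    optimalError (Matrix.diagonal fun k => (P k : ℂ)) (Matrix.diagonal fun k => (Q k : ℂ)) p q
      ≤ √(p * q) * ∑ k, √(P k) * √(Q k) := by
  have hpsd : ∀ f : κ → ℝ, (∀ k, 0 ≤ f k) → (Matrix.diagonal fun k => (f k : ℂ)).PosSemidef :=
    fun f hf => Matrix.posSemidef_diagonal_iff.2 fun k => by exact_mod_cast hf k
  have htr : ∀ f g : κ → ℝ, ((Matrix.diagonal fun k => (f k : ℂ)) *
      (Matrix.diagonal fun k => (g k : ℂ))).trace.re = ∑ k, f k * g k := by
    intro f g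
    rw [Matrix.diagonal_mul_diagonal, Matrix.trace_diagonal, Complex.re_sum]
    exact Finset.sum_congr rfl fun k _ => by rw [← Complex.ofReal_mul, Complex.ofReal_re]
  have hmem : ∑ k, min (p * P k) (q * Q k) ∈ {e : ℝ | ∃ M₁ M₂ : Matrix κ κ ℂ, M₁.PosSemidef ∧
      M₂.PosSemidef ∧ M₁ + M₂ = 1 ∧ e = p * (M₂ * Matrix.diagonal fun k => (P k : ℂ)).trace.re +
        q * (M₁ * Matrix.diagonal fun k => (Q k : ℂ)).trace.re} := by
    refine ⟨Matrix.diagonal fun k => ((if q * Q k ≤ p * P k then 1 else 0 : ℝ) : ℂ),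
      Matrix.diagonal fun k => ((if q * Q k ≤ p * P k then 0 else 1 : ℝ) : ℂ),
      hpsd _ fun k => by split_ifs <;> norm_num, hpsd _ fun k => by split_ifs <;> norm_num, ?_, ?_⟩
    · rw [Matrix.diagonal_add, ← Matrix.diagonal_one]
      congr 1
      ext k
      split_ifs <;> simp
    · rw [htr, htr, Finset.mul_sum, Finset.mul_sum, ← Finset.sum_add_distrib]
      refine Finset.sum_congr rfl fun k _ => ?_
      split_ifs with h
      · rw [min_eq_right h]; ring
      · rw [min_eq_left (not_le.1 h).le]; ring
  refine (csInf_le ⟨0, ?_⟩ hmem).trans ?_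
  · rintro e ⟨M₁, M₂, h₁, h₂, -, rfl⟩
    have := posSemidef_re_trace_mul_nonneg h₂ (hpsd P hP)
    have := posSemidef_re_trace_mul_nonneg h₁ (hpsd Q hQ)
    positivity
  · rw [Finset.mul_sum]
    refine Finset.sum_le_sum fun k _ => ?_
    have hx := mul_nonneg hp (hP k)
    have hy := mul_nonneg hq (hQ k)
    have e : √(p * q) * (√(P k) * √(Q k)) = √(p * P k) * √(q * Q k) := by
      rw [Real.sqrt_mul hp, Real.sqrt_mul hp, Real.sqrt_mul hq]
      ring
    rw [e, ← Real.sqrt_mul hx]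
    refine Real.le_sqrt_of_sq_le ?_
    rw [sq]
    exact mul_le_mul (min_le_left _ _) (min_le_right _ _) (le_min hx hy) hx

theorem tensorPower_diagonal {κ : Type*} [DecidableEq κ] (P : κ → ℝ) (n : ℕ) :
    tensorPower (Matrix.diagonal fun k => (P k : ℂ)) n =
      Matrix.diagonal fun x : Fin n → κ => ((∏ k, P (x k) : ℝ) : ℂ) := by
  ext x y
  rw [tensorPower, Matrix.of_apply]
  by_cases h : x = y
  · subst h
    simp
  · rw [Matrix.diagonal_apply_ne _ h]
    obtain ⟨k, hk⟩ := Function.ne_iff.1 h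
    exact Finset.prod_eq_zero (Finset.mem_univ k) (Matrix.diagonal_apply_ne _ hk)

theorem optimalError_tensorPower_diagonal_le {κ : Type*} [Fintype κ] [DecidableEq κ]
    {P Q : κ → ℝ} (hP : ∀ k, 0 ≤ P k) (hQ : ∀ k, 0 ≤ Q k) {p q : ℝ} (hp : 0 ≤ p) (hq : 0 ≤ q)
    (n : ℕ) :
    optimalError (tensorPower (Matrix.diagonal fun k => (P k : ℂ)) n)
      (tensorPower (Matrix.diagonal fun k => (Q k : ℂ)) n) p q
      ≤ √(p * q) * (∑ k, √(P k) * √(Q k)) ^ n := by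
  rw [tensorPower_diagonal, tensorPower_diagonal]
  refine (optimalError_diagonal_le (fun x => Finset.prod_nonneg fun k _ => hP _)
    (fun x => Finset.prod_nonneg fun k _ => hQ _) hp hq).trans_eq ?_
  congr 1
  have h := Finset.prod_univ_sum (fun _ : Fin n => (Finset.univ : Finset κ))
    fun _ k => √(P k) * √(Q k)
  rw [Finset.prod_const, Finset.card_univ, Fintype.card_fin, Fintype.piFinset_univ] at h
  rw [h]
  refine Finset.sum_congr rfl fun x _ => ?_
  rw [Finset.prod_mul_distrib, Real.sqrt_prod _ fun k _ => hP _, Real.sqrt_prod _ fun k _ => hQ _]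

/-- The Fuchs–van de Graaf inequality for Bernoulli distributions. -/
theorem bernoulli_fidelity_le {a b : ℝ} (ha0 : 0 ≤ a) (ha1 : a ≤ 1) (hb0 : 0 ≤ b) (hb1 : b ≤ 1) :
    √a * √b + √(1 - a) * √(1 - b) ≤ Real.exp (-((a - b) ^ 2 / 2)) := by
  have h1 := Real.sq_sqrt ha0
  have h2 := Real.sq_sqrt hb0
  have h3 := Real.sq_sqrt (sub_nonneg.2 ha1)
  have h4 := Real.sq_sqrt (sub_nonneg.2 hb1)
  refine abs_le_of_sq_le_sq' ?_ (Real.exp_pos _).le |>.2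
  have h5 : (√a * √b + √(1 - a) * √(1 - b)) ^ 2 ≤ 1 - (a - b) ^ 2 := by
    have h6 := sq_nonneg (√a * √(1 - a) - √b * √(1 - b))
    have e1 : (√a * √(1 - a) - √b * √(1 - b)) ^ 2 = √a ^ 2 * √(1 - a) ^ 2 + √b ^ 2 * √(1 - b) ^ 2
      - 2 * (√a * √b * (√(1 - a) * √(1 - b))) := by ring
    have e2 : (√a * √b + √(1 - a) * √(1 - b)) ^ 2 = √a ^ 2 * √b ^ 2 + √(1 - a) ^ 2 * √(1 - b) ^ 2
      + 2 * (√a * √b * (√(1 - a) * √(1 - b))) := by ring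
    rw [e1, h1, h2, h3, h4] at h6
    rw [e2, h1, h2, h3, h4]
    linarith
  refine h5.trans ?_
  rw [← Real.exp_nat_mul]
  have := Real.add_one_le_exp (-(a - b) ^ 2)
  have e : ((2 : ℕ) : ℝ) * -((a - b) ^ 2 / 2) = -(a - b) ^ 2 := by
    push_cast
    ring
  rw [e]
  linarith

theorem le_minEigenvalue_diagonal {κ : Type*} [Fintype κ] [DecidableEq κ] [Nonempty κ]
    {f : κ → ℝ} {c : ℝ} (hf : ∀ k, c ≤ f k) :
    c ≤ minEigenvalue (Matrix.diagonal fun k => (f k : ℂ)) := by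
  have hH : (Matrix.diagonal fun k => (f k : ℂ)).IsHermitian :=
    Matrix.isHermitian_diagonal_of_self_adjoint _ (by
      rw [isSelfAdjoint_iff]
      ext k
      simp)
  refine le_csInf ?_ fun μ hμ => ?_
  · rw [hH.spectrum_real_eq_range_eigenvalues]
    exact Set.range_nonempty _
  · by_contra hlt
    refine hμ ?_
    have : algebraMap ℝ (Matrix κ κ ℂ) μ - Matrix.diagonal (fun k => (f k : ℂ)) =
        Matrix.diagonal fun k => ((μ - f k : ℝ) : ℂ) := by
      rw [Matrix.algebraMap_eq_diagonal, Matrix.diagonal_sub]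
      congr 1
      ext k
      simp
    rw [spectrum.mem_resolventSet_iff, this, Matrix.isUnit_diagonal, Pi.isUnit_iff]
    intro k
    rw [isUnit_iff_ne_zero]
    have := hf k
    exact_mod_cast (by linarith : μ - f k < 0).ne

theorem trace_mul_eq_re {ι : Type*} [Fintype ι] [DecidableEq ι] {M ρ : Matrix ι ι ℂ}
    (hM : M.PosSemidef) (hρ : ρ.PosSemidef) : (M * ρ).trace = ((M * ρ).trace.re : ℂ) := by
  obtain ⟨R, hR, rfl⟩ := exists_posSemidef_sqrt hρ
  have h := (hM.conjTranspose_mul_mul_same R).trace_nonneg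
  rw [hR.isHermitian.eq, Matrix.mul_assoc, Matrix.trace_mul_comm, Matrix.mul_assoc] at h
  exact Complex.ext (by simp) (by simpa using (Complex.le_def.1 h).2.symm)

/-! ### Randomized response. -/

/-- Randomized response with parameter `β` applied to the outcome of the test `(E, 1 - E)`. -/
def randomizedResponse {ι : Type*} [Fintype ι] [DecidableEq ι] (β : ℝ) (E : Matrix ι ι ℂ) :
    Matrix ι ι ℂ →ₗ[ℂ] Matrix (Fin 2) (Fin 2) ℂ :=
  measurementChannel ![(β : ℂ) • 1 + ((1 - 2 * β : ℝ) : ℂ) • E,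
    (β : ℂ) • 1 + ((1 - 2 * β : ℝ) : ℂ) • (1 - E)]

section RandomizedResponse

variable {ι : Type*} [Fintype ι] [DecidableEq ι] {β : ℝ} {E : Matrix ι ι ℂ}

theorem randomizedResponse_isChannel (hβ0 : 0 ≤ β) (hβ1 : β ≤ 1 / 2) (hE : E.PosSemidef)
    (hE' : (1 - E).PosSemidef) : IsChannel (randomizedResponse β E) := by
  have hβ : (0 : ℂ) ≤ (β : ℂ) := by exact_mod_cast hβ0
  have hβ' : (0 : ℂ) ≤ ((1 - 2 * β : ℝ) : ℂ) := by exact_mod_cast (by linarith : 0 ≤ 1 - 2 * β)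
  refine measurementChannel_isChannel ?_ ?_
  · rw [Fin.forall_fin_two]
    exact ⟨(Matrix.PosSemidef.one.smul hβ).add (hE.smul hβ'),
      (Matrix.PosSemidef.one.smul hβ).add (hE'.smul hβ')⟩
  · rw [Fin.sum_univ_two]
    simp only [Matrix.cons_val_zero, Matrix.cons_val_one]
    push_cast
    module

theorem randomizedResponse_apply (hE : E.PosSemidef) {ω : Matrix ι ι ℂ} (hω : IsState ω) :
    randomizedResponse β E ω = Matrix.diagonal fun k =>
      ((![β + (1 - 2 * β) * (E * ω).trace.re, 1 - (β + (1 - 2 * β) * (E * ω).trace.re)] k : ℝ) : ℂ)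
      := by
  have h := trace_mul_eq_re hE hω.1
  simp only [randomizedResponse, measurementChannel, LinearMap.coe_mk, AddHom.coe_mk]
  congr 1
  ext k
  fin_cases k
  · simp [Matrix.add_mul, Matrix.trace_add, Matrix.trace_smul, hω.2, ← h]
  · simp [Matrix.add_mul, Matrix.sub_mul, Matrix.trace_add, Matrix.trace_sub, Matrix.trace_smul,
      hω.2, ← h]
    ring

theorem re_trace_mem_Icc (hE : E.PosSemidef) (hE' : (1 - E).PosSemidef) {ω : Matrix ι ι ℂ}
    (hω : IsState ω) : (E * ω).trace.re ∈ Set.Icc (0 : ℝ) 1 := by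
  have h := posSemidef_re_trace_mul_nonneg hE' hω.1
  rw [Matrix.sub_mul, Matrix.one_mul, Matrix.trace_sub, hω.2, Complex.sub_re, Complex.one_re] at h
  exact ⟨posSemidef_re_trace_mul_nonneg hE hω.1, by linarith⟩

theorem randomizedResponse_prob_mem_Icc (hβ1 : β ≤ 1 / 2) (hE : E.PosSemidef)
    (hE' : (1 - E).PosSemidef) {ω : Matrix ι ι ℂ} (hω : IsState ω) :
    β + (1 - 2 * β) * (E * ω).trace.re ∈ Set.Icc β (1 - β) := by
  obtain ⟨h0, h1⟩ := re_trace_mem_Icc hE hE' hω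
  constructor <;> nlinarith

theorem randomizedResponse_isInstanceChannel {ε : ℝ} (hε : 0 < ε) (hE : E.PosSemidef)
    (hE' : (1 - E).PosSemidef) {ρ : Matrix ι ι ℂ} (hρ : IsState ρ) (σ : Matrix ι ι ℂ) :
    IsInstanceChannel ε ρ σ (randomizedResponse (1 / (Real.exp ε + 1)) E) := by
  have hx : 1 < Real.exp ε := Real.one_lt_exp_iff.2 hε
  have hx1 : 0 < Real.exp ε + 1 := by linarith
  set β := 1 / (Real.exp ε + 1) with hβ
  have hβ0 : 0 ≤ β := by positivity
  have hβ1 : β ≤ 1 / 2 := by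
    rw [hβ]
    gcongr
    linarith
  -- This fixes the choice of β: outcome probabilities lie in [β, 1 - β], so their ratios are at
  -- most e^ε and the output eigenvalues are at least β.
  have hβx : 1 - β = Real.exp ε * β := by
    rw [hβ]
    field_simp
    ring
  refine ⟨randomizedResponse_isChannel hβ0 hβ1 hE hE', ?_, ?_⟩
  · intro ω ω' hω hω' M hM _
    have key : ∀ η : Matrix ι ι ℂ, IsState η → (M * randomizedResponse β E η).trace.re =
        (M 0 0).re * (β + (1 - 2 * β) * (E * η).trace.re) +
        (M 1 1).re * (1 - (β + (1 - 2 * β) * (E * η).trace.re)) := by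
      intro η hη
      rw [randomizedResponse_apply hE hη, Matrix.trace, Fin.sum_univ_two]
      simp only [Matrix.diag_apply, Matrix.mul_diagonal, Matrix.cons_val_zero,
        Matrix.cons_val_one, Complex.add_re, Complex.re_mul_ofReal]
    rw [key ω hω, key ω' hω', mul_add (Real.exp ε), mul_left_comm (Real.exp ε),
      mul_left_comm (Real.exp ε)]
    have hM0 : ∀ i, 0 ≤ (M i i).re := fun i => (Complex.le_def.1 hM.diag_nonneg).1
    obtain ⟨h0, h1⟩ := randomizedResponse_prob_mem_Icc hβ1 hE hE' hω
    obtain ⟨h0', h1'⟩ := randomizedResponse_prob_mem_Icc hβ1 hE hE' hω'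
    refine add_le_add (mul_le_mul_of_nonneg_left ?_ (hM0 0))
      (mul_le_mul_of_nonneg_left ?_ (hM0 1))
    · exact h1.trans (hβx.trans_le (by gcongr))
    · exact (by linarith : _ ≤ 1 - β).trans (hβx.trans_le (by gcongr; linarith))
  · refine le_max_of_le_left ?_
    rw [randomizedResponse_apply hE hρ]
    obtain ⟨h0, h1⟩ := randomizedResponse_prob_mem_Icc hβ1 hE hE' hρ
    refine le_minEigenvalue_diagonal (Fin.forall_fin_two.2 ⟨h0, ?_⟩)
    exact (by linarith : β ≤ 1 - (β + (1 - 2 * β) * (E * ρ).trace.re))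

end RandomizedResponse

/-! ### Both bounds on the private sample complexity, and the asymptotics. -/

/-- The upper bound on the private sample complexity. -/
theorem instancePrivateSampleComplexity_le {ι : Type*} [Fintype ι] [DecidableEq ι]
    {ρ σ : Matrix ι ι ℂ} (hρ : IsState ρ) (hσ : IsState σ) (hne : ρ ≠ σ) {ε α p q : ℝ}
    (hε : 0 < ε) (hα : 0 < α) (hp : 0 < p) (hq : 0 < q) :
    instancePrivateSampleComplexity ε ρ σ α p q ≤
      (⌈2 * Real.log (√(p * q) / α) *
        ((Real.exp ε + 1) / ((Real.exp ε - 1) * traceDist ρ σ)) ^ 2⌉₊ : ℕ∞) := by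
  obtain ⟨hτ, -, -, E, hE, hE', hEτ⟩ := exists_jordan hρ hσ hne
  set n := ⌈2 * Real.log (√(p * q) / α) *
        ((Real.exp ε + 1) / ((Real.exp ε - 1) * traceDist ρ σ)) ^ 2⌉₊ with hn
  have hx : 1 < Real.exp ε := Real.one_lt_exp_iff.2 hε
  have hx1 : 0 < Real.exp ε + 1 := by linarith
  have hx0 : 0 < Real.exp ε - 1 := by linarith
  have hpq : 0 < √(p * q) := Real.sqrt_pos.2 (mul_pos hp hq)
  refine iInf_le_of_le 2 (iInf_le_of_le _ (iInf_le_of_le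
    (randomizedResponse_isInstanceChannel hε hE hE' hρ σ) (iInf_le_of_le n (iInf_le_of_le ?_ le_rfl))))
  have hβ1 : 1 / (Real.exp ε + 1) ≤ 1 / 2 := by
    gcongr
    linarith
  have hβ0 : 0 ≤ 1 / (Real.exp ε + 1) := by positivity
  rw [randomizedResponse_apply hE hρ, randomizedResponse_apply hE hσ]
  obtain ⟨a0, a1⟩ := randomizedResponse_prob_mem_Icc hβ1 hE hE' hρ
  obtain ⟨b0, b1⟩ := randomizedResponse_prob_mem_Icc hβ1 hE hE' hσ
  set a := 1 / (Real.exp ε + 1) + (1 - 2 * (1 / (Real.exp ε + 1))) * (E * ρ).trace.re with ha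
  set b := 1 / (Real.exp ε + 1) + (1 - 2 * (1 / (Real.exp ε + 1))) * (E * σ).trace.re with hb
  have hab : a - b = (Real.exp ε - 1) * traceDist ρ σ / (Real.exp ε + 1) := by
    rw [← hEτ, ha, hb]
    field_simp
    ring
  have hab0 : 0 < a - b := by
    rw [hab]
    positivity
  have hinv : ((Real.exp ε + 1) / ((Real.exp ε - 1) * traceDist ρ σ)) = (a - b)⁻¹ := by
    rw [hab, inv_div]
  rw [hinv] at hn
  refine (optimalError_tensorPower_diagonal_le
    (Fin.forall_fin_two.2 ⟨hβ0.trans a0, (by linarith : 0 ≤ 1 - a)⟩)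
    (Fin.forall_fin_two.2 ⟨hβ0.trans b0, (by linarith : 0 ≤ 1 - b)⟩)
    hp.le hq.le n).trans ?_
  rw [Fin.sum_univ_two]
  change √(p * q) * (√a * √b + √(1 - a) * √(1 - b)) ^ n ≤ α
  have h1 := bernoulli_fidelity_le (hβ0.trans a0) (by linarith) (hβ0.trans b0)
    (by linarith : b ≤ 1)
  have h2 : Real.log (√(p * q) / α) ≤ n * ((a - b) ^ 2 / 2) := by
    have h3 := Nat.le_ceil (2 * Real.log (√(p * q) / α) * (a - b)⁻¹ ^ 2)
    rw [← hn, inv_pow, ← div_eq_mul_inv, div_le_iff₀ (by positivity)] at h3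
    linarith
  have h4 : √(p * q) ≤ Real.exp (n * ((a - b) ^ 2 / 2)) * α := by
    rw [← div_le_iff₀ hα]
    exact (Real.log_le_iff_le_exp (by positivity)).1 h2
  calc _ ≤ √(p * q) * Real.exp (-((a - b) ^ 2 / 2)) ^ n := by gcongr
    _ = √(p * q) / Real.exp (n * ((a - b) ^ 2 / 2)) := by
      rw [← Real.exp_nat_mul, mul_neg, Real.exp_neg, ← div_eq_mul_inv]
    _ ≤ α := by
      rw [div_le_iff₀ (Real.exp_pos _)]
      linarith

theorem exists_instancePrivateSampleComplexity_eq {ι : Type*} [Fintype ι] [DecidableEq ι]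
    {ρ σ : Matrix ι ι ℂ} (hρ : IsState ρ) (hσ : IsState σ) (hne : ρ ≠ σ) {ε α p q : ℝ}
    (hε : 0 < ε) (hα : 0 < α) (hp : 0 < p) (hq : 0 < q) (hpq : p + q = 1) :
    ∃ n : ℕ, instancePrivateSampleComplexity ε ρ σ α p q = (n : ℕ∞) ∧
      Real.log (p * q / α) * (1 / (Real.exp ε + 1)) *
          ((Real.exp ε + 1) / ((Real.exp ε - 1) * traceDist ρ σ)) ^ 2 ≤ (n : ℝ) ∧
      n ≤ ⌈2 * Real.log (√(p * q) / α) *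
          ((Real.exp ε + 1) / ((Real.exp ε - 1) * traceDist ρ σ)) ^ 2⌉₊ := by
  have hup := instancePrivateSampleComplexity_le hρ hσ hne hε hα hp hq
  obtain ⟨hτ, -, ⟨ω, ω', hω, hω', hωω'⟩, -⟩ := exists_jordan hρ hσ hne
  have hlow : (⌈Real.log (p * q / α) * (1 / (Real.exp ε + 1)) *
          ((Real.exp ε + 1) / ((Real.exp ε - 1) * traceDist ρ σ)) ^ 2⌉₊ : ℕ∞) ≤
      instancePrivateSampleComplexity ε ρ σ α p q := by
    refine le_iInf fun m => le_iInf fun Φ => le_iInf fun hΦ => le_iInf fun n => le_iInf fun hn => ?_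
    exact_mod_cast Nat.ceil_le.2
      (le_of_optimalError_le hε hτ hp hq hpq hα hρ hσ hω hω' hωω' hΦ hn)
  obtain ⟨n, hn⟩ := ENat.ne_top_iff_exists.1 (ne_top_of_le_ne_top (ENat.natCast_ne_top _) hup)
  rw [← hn] at hup hlow
  exact ⟨n, hn.symm, Nat.ceil_le.1 (by exact_mod_cast hlow), by exact_mod_cast hup⟩

end QuantumPrivacy

end

theorem mainTheorem8 (p q α : ℝ) (hp0 : 0 < p) (hp1 : p < 1) (hq : q = 1 - p)
    (hα0 : 0 < α) (hα1 : α < p * q) :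
    (∀ (ε : ℝ), 0 < ε → ∀ (d : ℕ) (ρ σ : Matrix (Fin d) (Fin d) ℂ),
      QuantumPrivacy.IsState ρ → QuantumPrivacy.IsState σ → ρ ≠ σ →
      ∃ n : ℕ, QuantumPrivacy.instancePrivateSampleComplexity ε ρ σ α p q = (n : ℕ∞) ∧
        Real.log (p * q / α) * (1 / (Real.exp ε + 1)) *
            ((Real.exp ε + 1) / ((Real.exp ε - 1) * QuantumPrivacy.traceDist ρ σ)) ^ 2
          ≤ (n : ℝ) ∧
        n ≤ ⌈2 * Real.log (Real.sqrt (p * q) / α) *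
            ((Real.exp ε + 1) / ((Real.exp ε - 1) * QuantumPrivacy.traceDist ρ σ)) ^ 2⌉₊) ∧
    (∃ c C : ℝ, 0 < c ∧ 0 < C ∧
      ∀ (ε : ℝ), 0 < ε → ε < 1 → ∀ (d : ℕ) (ρ σ : Matrix (Fin d) (Fin d) ℂ),
        QuantumPrivacy.IsState ρ → QuantumPrivacy.IsState σ → ρ ≠ σ →
        ∃ n : ℕ, QuantumPrivacy.instancePrivateSampleComplexity ε ρ σ α p q = (n : ℕ∞) ∧
          c * (1 / (ε * QuantumPrivacy.traceDist ρ σ)) ^ 2 ≤ (n : ℝ) ∧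
          (n : ℝ) ≤ C * (1 / (ε * QuantumPrivacy.traceDist ρ σ)) ^ 2) := by
  have hq0 : 0 < q := by linarith
  have hpq : 0 < p * q := mul_pos hp0 hq0
  have hpq1 : p * q < 1 := by nlinarith
  have hL : 0 < Real.log (p * q / α) := Real.log_pos ((one_lt_div hα0).2 hα1)
  have hL' : 0 < Real.log (√(p * q) / α) := by
    refine Real.log_pos ((one_lt_div hα0).2 (hα1.trans ?_))
    exact Real.lt_sqrt_of_sq_lt (by nlinarith)
  have main := fun (ε : ℝ) (hε : 0 < ε) (d : ℕ) (ρ σ : Matrix (Fin d) (Fin d) ℂ)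
    (hρ : QuantumPrivacy.IsState ρ) (hσ : QuantumPrivacy.IsState σ) (hne : ρ ≠ σ) =>
    QuantumPrivacy.exists_instancePrivateSampleComplexity_eq hρ hσ hne hε hα0 hp0 hq0
      (by linarith : p + q = 1)
  -- For ε < 1 one has ε ≤ e^ε - 1 ≤ 2ε and 2 ≤ e^ε + 1 ≤ 4. The lower constant is 2/2² = 1/2 times
  -- the logarithm, the upper one 2·4² = 32 times it. The extra 1 pays for the ceiling, since ετ ≤
  -- 1.
  refine ⟨main, Real.log (p * q / α) / 2, 32 * Real.log (√(p * q) / α) + 1, by positivity,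
    by positivity, ?_⟩
  intro ε hε hε1 d ρ σ hρ hσ hne
  obtain ⟨n, hn, hlow, hup⟩ := main ε hε d ρ σ hρ hσ hne
  obtain ⟨hτ, hτ1, -, -⟩ := QuantumPrivacy.exists_jordan hρ hσ hne
  set τ := QuantumPrivacy.traceDist ρ σ
  have hx1 : ε ≤ Real.exp ε - 1 := by linarith [Real.add_one_le_exp ε]
  have hx2 : Real.exp ε - 1 ≤ 2 * ε := by
    have := Real.abs_exp_sub_one_le (x := ε) (by rw [abs_of_pos hε]; exact hε1.le)
    rwa [abs_of_pos (by linarith), abs_of_pos hε] at this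
  have hx0 : 0 < Real.exp ε - 1 := hε.trans_le hx1
  refine ⟨n, hn, le_trans ?_ hlow, ?_⟩
  · have e : Real.log (p * q / α) * (1 / (Real.exp ε + 1)) *
        ((Real.exp ε + 1) / ((Real.exp ε - 1) * τ)) ^ 2 =
        Real.log (p * q / α) * ((Real.exp ε + 1) / ((Real.exp ε - 1) * τ) ^ 2) := by
      field_simp
    rw [e, div_mul_eq_mul_div, mul_div_assoc]
    refine mul_le_mul_of_nonneg_left ?_ hL.le
    calc (1 / (ε * τ)) ^ 2 / 2 = 2 / (2 * ε * τ) ^ 2 := by field_simp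
      _ ≤ (Real.exp ε + 1) / ((Real.exp ε - 1) * τ) ^ 2 := by
        gcongr
        linarith
  · have h1 : (n : ℝ) ≤ 2 * Real.log (√(p * q) / α) *
        ((Real.exp ε + 1) / ((Real.exp ε - 1) * τ)) ^ 2 + 1 :=
      le_trans (by exact_mod_cast hup) (Nat.ceil_lt_add_one (by positivity)).le
    have h2 : (Real.exp ε + 1) / ((Real.exp ε - 1) * τ) ≤ 4 * (1 / (ε * τ)) := by
      rw [mul_one_div]
      gcongr
      linarith
    have h3 : 1 ≤ 1 / (ε * τ) := by
      rw [one_le_div (by positivity)]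
      nlinarith
    have h4 : ((Real.exp ε + 1) / ((Real.exp ε - 1) * τ)) ^ 2 ≤ (4 * (1 / (ε * τ))) ^ 2 := by
      gcongr
    have h5 : 2 * Real.log (√(p * q) / α) * ((Real.exp ε + 1) / ((Real.exp ε - 1) * τ)) ^ 2 ≤
        2 * Real.log (√(p * q) / α) * (4 * (1 / (ε * τ))) ^ 2 := by gcongr
    nlinarith
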